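/- **Theorem 5 (Strong consistency).** Let $n\ge 2$, let $A^*\in\mathbb{R}^{n\times n}$ be an arbitrary matrix with rows $A^*_1,\dots,A^*_n$, and let $c^*\in\mathbb{R}^n$. On a probability space consider the system $$Y_{k+1}=A^*S_k+D_k,\qquad S_k=\big(\mathbb{I}_{[Y_{k,1}\ge c^*_1]},\dots,\mathbb{I}_{[Y_{k,n}\ge c^*_n]}\big)^T\in\{0,1\}^n,\qquad k\ge 0,$$ with random initial state $Y_0$, where the $D_{k,i}$ ($k\ge0$, $1\le i\le n$) are mutually independent standard Gaussian random variables, and the family of all of them is independent of $S_0$. Let $\theta^*=\mathrm{vec}\{(A^*\ c^*)\}\in\mathbb{R}^{n(n+1)}$ be the true parameter vector, and write a general $\theta=\mathrm{vec}\{(A\ c)\}\in\mathbb{R}^{n(n+1)}$ in blocks $\theta^{(i)}=(A_i\ c_i)^T\in\mathbb{R}^{n+1}$, $1\le i\le n$. With $\Phi$ the standard Gaussian distribution function, put, for $\tilde s=(s',s)\in\{0,1\}^n\times\{0,1\}^n$, $$g_i(\tilde s\,|\,\theta^{(i)})=\big(1-\Phi(c_i-A_is)\big)^{s'_i}\,\Phi(c_i-A_is)^{1-s'_i},\qquad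 K(\theta,\tilde s)=\Big(\nabla_{\theta^{(i)}}\log g_i(\tilde s\,|\,\theta^{(i)})\Big)_{1\le i\le n}\in\mathbb{R}^{n(n+1)},$$ and let $\tilde S_k=(S_k,S_{k-1})$ for $k\ge1$. Let the step sizes satisfy $a_k>0$ for all $k\ge 0$, $\sum_{k\ge1} a_k=\infty$ and $\sum_{k\ge1} a_k^2<\infty$. Then, for every fixed initial value $\theta_0\in\mathbb{R}^{n(n+1)}$: 1. the estimates defined by $\theta_{k+1}=\theta_k+a_kK(\theta_k,\tilde S_{k+1})$, $k\ge0$, satisfy $P\{\lim_{k\to\infty}\theta_k=\theta^*\}=1$; 2. the same holds for the variant with expanding truncations: for every nondecreasing sequence of positive numbers $M_k\to\infty$, the estimates defined for $k\ge0$, with $U_k=\theta_k+a_kK(\theta_k,\tilde S_{k+1})$, by $$\theta_{k+1}=U_k\,\mathbb{I}_{[\|U_k\|\le M_{\sigma_k}]},\qquad \sigma_k=\sum_{i=1}^{k-1}\mathbb{I}_{[\|U_i\|>M_{\sigma_i}]}$$ (so $\sigma_0=\sigma_1=0$; $\|\cdot\|$ is the Euclidean norm) satisfy $P\{\lim_{k\to\infty}\theta_k=\theta^*\}=1$,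 and almost surely only finitely many truncations occur, that is, $\|U_k\|>M_{\sigma_k}$ for only finitely many $k$. -/

import Mathlib

open MeasureTheory ProbabilityTheory Filter Topology

noncomputable section

namespace BinaryNetwork

/-- Binary vectors `{0,1}ⁿ`. -/
abbrev BinVec (n : ℕ) := Fin n → Fin 2

/-- A binary vector regarded as a vector of real numbers. -/
def BinVec.toReal {n : ℕ} (s : BinVec n) : Fin n → ℝ := fun i => ((s i : ℕ) : ℝ)

/-- The quantizer: entry `i` is `1` if `y i ≥ c i` and `0` otherwise. -/
def quantizer {n : ℕ} (y c : Fin n → ℝ) : BinVec n := fun i => if c i ≤ y i then 1 else 0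

/-- The dynamics `Y_{k+1} = A S_k + D_k`, `S_k = Q(Y_k, c)`. -/
structure IsSystem {n : ℕ} {Ω : Type*} (A : Matrix (Fin n) (Fin n) ℝ) (c : Fin n → ℝ)
    (D Y : ℕ → Ω → Fin n → ℝ) (S : ℕ → Ω → BinVec n) : Prop where
  state : ∀ k ω, Y (k + 1) ω = A.mulVec (S k ω).toReal + D k ω
  obs : ∀ k ω, S k ω = quantizer (Y k ω) c

/-- The scalar disturbances `D_{k,i}` are standard Gaussian random variables which are mutually
independent over all pairs `(k, i)`, and the whole family is independent of `S_0`. -/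
structure GaussianDisturbances {n : ℕ} {Ω : Type*} [MeasurableSpace Ω] (P : Measure Ω)
    (D : ℕ → Ω → Fin n → ℝ) (S₀ : Ω → BinVec n) : Prop where
  measurable : ∀ k i, Measurable fun ω => D k ω i
  law : ∀ k i, P.map (fun ω => D k ω i) = gaussianReal 0 1
  indep : iIndepFun (fun (p : ℕ × Fin n) (ω : Ω) => D p.1 ω p.2) P
  indep_init : IndepFun (fun (ω : Ω) (p : ℕ × Fin n) => D p.1 ω p.2) S₀ P

/-- Step sizes: `a_k > 0`, `∑ a_k = ∞`, `∑ a_k² < ∞`. -/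
structure StepSize (a : ℕ → ℝ) : Prop where
  pos : ∀ k, 0 < a k
  sum_eq_top : Tendsto (fun N => ∑ k ∈ Finset.Icc 1 N, a k) atTop atTop
  sum_sq : Summable fun k => a k ^ 2

/-- The space of one row `(A_i c_i)` of parameters: the first `n` coordinates are `A_i`, the last
one is `c_i`. -/
abbrev RowParam (n : ℕ) := EuclideanSpace ℝ (Fin (n + 1))

/-- The space `ℝ^{n(n+1)}` of parameters with its Euclidean norm; the entries of `vec (A c)` are
indexed by their position in the `n × (n+1)` matrix `(A c)`. -/
abbrev Param (n : ℕ) := EuclideanSpace ℝ (Fin n × Fin (n + 1))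

/-- `vec (A c)`. -/
def vec {n : ℕ} (A : Matrix (Fin n) (Fin n) ℝ) (c : Fin n → ℝ) : Param n :=
  WithLp.toLp 2 fun p => Fin.snoc (α := fun _ => ℝ) (A p.1) (c p.1) p.2

/-- The block `θ^{(i)}` of `θ`. -/
def block {n : ℕ} (θ : Param n) (i : Fin n) : RowParam n := WithLp.toLp 2 fun j => θ (i, j)

/-- The cumulative distribution function of the standard Gaussian distribution. -/
def stdCdf (x : ℝ) : ℝ := cdf (gaussianReal 0 1) x

/-- `c_i - A_i s` for the row parameter `ϑ = (A_i c_i)`. -/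
def threshold {n : ℕ} (ϑ : RowParam n) (s : BinVec n) : ℝ :=
  ϑ (Fin.last n) - ∑ j : Fin n, ϑ j.castSucc * s.toReal j

/-- `g_i(s̃ | θ^{(i)})`. An element of `{0,1}^{2n}` is written as the pair of its first half (the
current observation) and its second half (the previous observation). -/
def likelihood {n : ℕ} (i : Fin n) (s : BinVec n × BinVec n) (ϑ : RowParam n) : ℝ :=
  (1 - stdCdf (threshold ϑ s.2)) ^ (s.1 i : ℕ) * stdCdf (threshold ϑ s.2) ^ (1 - (s.1 i : ℕ))

/-- `K_i(θ^{(i)}, s̃) = ∇ log g_i(s̃ | θ^{(i)})`, the gradient with respect to `θ^{(i)}`. -/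
def scoreRow {n : ℕ} (i : Fin n) (ϑ : RowParam n) (s : BinVec n × BinVec n) : RowParam n :=
  gradient (fun η : RowParam n => Real.log (likelihood i s η)) ϑ

/-- `K(θ, s̃) = (K_1(θ^{(1)}, s̃), …, K_n(θ^{(n)}, s̃))`. -/
def score {n : ℕ} (θ : Param n) (s : BinVec n × BinVec n) : Param n :=
  WithLp.toLp 2 fun p => scoreRow p.1 (block θ p.1) s p.2

/-- The auxiliary chain `S̃_k = (S_k, S_{k-1})`, meaningful for `k ≥ 1`. -/
def auxChain {n : ℕ} {Ω : Type*} (S : ℕ → Ω → BinVec n) (k : ℕ) (ω : Ω) : BinVec n × BinVec n :=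
  (S k ω, S (k - 1) ω)

/-- `θ_k + a_k K(θ_k, S̃_{k+1})`. -/
def update {n : ℕ} {Ω : Type*} (a : ℕ → ℝ) (S : ℕ → Ω → BinVec n) (θ : ℕ → Ω → Param n)
    (k : ℕ) (ω : Ω) : Param n :=
  θ k ω + a k • score (θ k ω) (auxChain S (k + 1) ω)

/-- The estimates `θ_{k+1} = θ_k + a_k K(θ_k, S̃_{k+1})` with initial value `θ₀`. -/
structure IsEstimate {n : ℕ} {Ω : Type*} (a : ℕ → ℝ) (S : ℕ → Ω → BinVec n) (θ₀ : Param n)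
    (θ : ℕ → Ω → Param n) : Prop where
  init : ∀ ω, θ 0 ω = θ₀
  step : ∀ k ω, θ (k + 1) ω = update a S θ k ω

/-- The estimates with expanding truncations at the levels `M`: the update is replaced by `0` when
its norm exceeds `M_{σ_k}`, and `σ_k` counts the truncations at the times `1, …, k - 1`. -/
structure IsTruncatedEstimate {n : ℕ} {Ω : Type*} (a M : ℕ → ℝ) (S : ℕ → Ω → BinVec n)
    (θ₀ : Param n) (θ : ℕ → Ω → Param n) (σ : ℕ → Ω → ℕ) : Prop where
  init : ∀ ω, θ 0 ω = θ₀
  step : ∀ k ω, θ (k + 1) ω = if ‖update a S θ k ω‖ ≤ M (σ k ω) then update a S θ k ω else 0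
  count : ∀ k ω, σ k ω =
    ∑ i ∈ Finset.Ico 1 k, if M (σ i ω) < ‖update a S θ i ω‖ then 1 else 0

end BinaryNetwork

end

noncomputable section

namespace BinaryNetwork

/-! ### The standard Gaussian distribution function -/

/-! The recursion is a Robbins–Monro scheme with Lyapunov function `‖θ - θ'‖ ^ 2`, where `θ'` is the
true parameter. Given `S_k = s`, the mean of `⟪θ - θ', K⟫` is `-driftGap θ' θ s`, a sum of scalar
terms carrying the sign of `(t - u) * (Φ t - Φ u)`, so it is never positive because `Φ` increases
(`sum_transProb_mul_inner_score`, `slopeGap_pos`).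

The gap may vanish at a single state although `θ ≠ θ'`, but its sum over all states cannot
(`sum_driftGap_pos`). Every transition has probability at least some `ρ > 0`, so the gap at the next
state has conditional mean at least `ρ` times that sum. This one-step lookahead deals with the
Markov dependence without ergodic theory.

The noise consists of innovations of a finite-state chain. With square-summable weights and bounded
innovations, their series are `L²`-bounded martingales and converge
(`HasTransProb.ae_tendsto_sum_innovation`). The remaining argument is pathwise. The score grows at
most linearly, so normalised noise gives boundedness of the plain recursion (`bounded_of_step`);
with truncations, a late reset to `0` is never followed by another (`finite_truncations`). A bounded
path that eventually follows the recursion converges to `θ'` (`tendsto_of_step`). -/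

/-- The density of the standard Gaussian distribution. -/
def stdPdf (x : ℝ) : ℝ := gaussianPDFReal 0 1 x

lemma stdPdf_eq (x : ℝ) : stdPdf x = (√(2 * Real.pi))⁻¹ * Real.exp (-x ^ 2 / 2) := by
  simp [stdPdf, gaussianPDFReal]

lemma stdPdf_pos (x : ℝ) : 0 < stdPdf x := gaussianPDFReal_pos 0 1 x one_ne_zero

lemma continuous_stdPdf : Continuous stdPdf := by
  rw [show stdPdf = _ from funext stdPdf_eq]
  fun_prop

lemma stdCdf_eq_integral (x : ℝ) : stdCdf x = ∫ y in Set.Iic x, stdPdf y := by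
  rw [stdCdf, cdf_eq_real, measureReal_def, gaussianReal_apply_eq_integral 0 one_ne_zero,
    ENNReal.toReal_ofReal]
  · rfl
  · exact integral_nonneg fun y => gaussianPDFReal_nonneg 0 1 y

lemma hasDerivAt_stdCdf (x : ℝ) : HasDerivAt stdCdf (stdPdf x) x := by
  have hint : Integrable stdPdf := integrable_gaussianPDFReal 0 1
  have h : stdCdf = fun u => stdCdf 0 + ∫ y in (0 : ℝ)..u, stdPdf y := by
    funext u
    rw [stdCdf_eq_integral u, stdCdf_eq_integral 0,
      ← intervalIntegral.integral_Iic_sub_Iic hint.integrableOn hint.integrableOn]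
    ring
  rw [h]
  exact (intervalIntegral.integral_hasDerivAt_right hint.intervalIntegrable
    continuous_stdPdf.stronglyMeasurable.stronglyMeasurableAtFilter
    continuous_stdPdf.continuousAt).const_add _

lemma continuous_stdCdf : Continuous stdCdf :=
  continuous_iff_continuousAt.2 fun x => (hasDerivAt_stdCdf x).continuousAt

lemma strictMono_stdCdf : StrictMono stdCdf :=
  strictMono_of_deriv_pos fun x => by rw [(hasDerivAt_stdCdf x).deriv]; exact stdPdf_pos x

lemma stdCdf_pos (x : ℝ) : 0 < stdCdf x :=
  (cdf_nonneg (gaussianReal 0 1) (x - 1)).trans_lt (strictMono_stdCdf (by linarith))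

lemma stdCdf_lt_one (x : ℝ) : stdCdf x < 1 :=
  (strictMono_stdCdf (by linarith : x < x + 1)).trans_le (cdf_le_one (gaussianReal 0 1) (x + 1))

/-- On this window `(ξ ^ 2 - t ^ 2) / 2 = t * (ξ - t) + (ξ - t) ^ 2 / 2` is at most `3 / 2`. -/
lemma stdPdf_le_of_abs_sub_le {t ξ : ℝ} (h : |ξ - t| ≤ 1 / (1 + |t|)) :
    stdPdf t ≤ Real.exp 2 * stdPdf ξ := by
  have ht : 0 ≤ |t| := abs_nonneg t
  have hd : 1 / (1 + |t|) ≤ 1 := by rw [div_le_one (by linarith)]; linarith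
  have hd' : |t| * (1 / (1 + |t|)) ≤ 1 := by
    rw [mul_one_div, div_le_one (by linarith)]; linarith
  have h1 : |t| * |ξ - t| ≤ 1 := (mul_le_mul_of_nonneg_left h ht).trans hd'
  have h2 : t * (ξ - t) ≤ 1 := (le_abs_self _).trans (by rwa [abs_mul])
  have h3 : (ξ - t) ^ 2 ≤ 1 := by
    rw [← sq_abs]; exact pow_le_one₀ (abs_nonneg _) (h.trans hd)
  rw [stdPdf_eq, stdPdf_eq, mul_left_comm, ← Real.exp_add]
  gcongr
  nlinarith

/-- A crude Mills-ratio bound: by the mean value theorem the window of length `1 / (1 + |t|)` to the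
left of `t` already carries mass comparable to `stdPdf t / (1 + |t|)`. It yields the linear growth
of the score. -/
lemma stdPdf_le_stdCdf (t : ℝ) : stdPdf t ≤ Real.exp 2 * (1 + |t|) * stdCdf t := by
  have ht : 0 < 1 + |t| := by positivity
  have hδ : 0 < 1 / (1 + |t|) := by positivity
  obtain ⟨ξ, hξ, h⟩ := exists_hasDerivAt_eq_slope stdCdf stdPdf
    (by linarith : t - 1 / (1 + |t|) < t) continuous_stdCdf.continuousOn
    fun x _ => hasDerivAt_stdCdf x
  have h1 := stdPdf_le_of_abs_sub_le (t := t) (ξ := ξ)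
    (by rw [abs_le]; constructor <;> linarith [hξ.1, hξ.2])
  have h2 : stdPdf ξ ≤ (1 + |t|) * stdCdf t := by
    rw [h, sub_sub_cancel, div_div_eq_mul_div, div_one, mul_comm]
    have := stdCdf_pos (t - 1 / (1 + |t|))
    gcongr
    linarith
  calc _ ≤ _ := h1
    _ ≤ Real.exp 2 * ((1 + |t|) * stdCdf t) := by gcongr
    _ = _ := by ring

lemma stdPdf_le_one_sub_stdCdf (t : ℝ) :
    stdPdf t ≤ Real.exp 2 * (1 + |t|) * (1 - stdCdf t) := by
  have ht : 0 < 1 + |t| := by positivity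
  have hδ : 0 < 1 / (1 + |t|) := by positivity
  obtain ⟨ξ, hξ, h⟩ := exists_hasDerivAt_eq_slope stdCdf stdPdf
    (by linarith : t < t + 1 / (1 + |t|)) continuous_stdCdf.continuousOn
    fun x _ => hasDerivAt_stdCdf x
  have h1 := stdPdf_le_of_abs_sub_le (t := t) (ξ := ξ)
    (by rw [abs_le]; constructor <;> linarith [hξ.1, hξ.2])
  have h2 : stdPdf ξ ≤ (1 + |t|) * (1 - stdCdf t) := by
    rw [h, add_sub_cancel_left, div_div_eq_mul_div, div_one, mul_comm]
    have := stdCdf_lt_one (t + 1 / (1 + |t|))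
    gcongr
  calc _ ≤ _ := h1
    _ ≤ Real.exp 2 * ((1 + |t|) * (1 - stdCdf t)) := by gcongr
    _ = _ := by ring

/-! ### The scalar probit model -/

/-- The probability of the binary outcome `b` when the threshold is `t`. -/
def outcomeProb (b : Fin 2) (t : ℝ) : ℝ :=
  (1 - stdCdf t) ^ (b : ℕ) * stdCdf t ^ (1 - (b : ℕ))

/-- The logarithmic derivative of `outcomeProb b`. -/
def logSlope (b : Fin 2) (t : ℝ) : ℝ :=
  if b = 0 then stdPdf t / stdCdf t else -(stdPdf t / (1 - stdCdf t))

@[simp] lemma outcomeProb_zero (t : ℝ) : outcomeProb 0 t = stdCdf t := by simp [outcomeProb]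

@[simp] lemma outcomeProb_one (t : ℝ) : outcomeProb 1 t = 1 - stdCdf t := by simp [outcomeProb]

lemma outcomeProb_pos (b : Fin 2) (t : ℝ) : 0 < outcomeProb b t :=
  mul_pos (pow_pos (by linarith [stdCdf_lt_one t]) _) (pow_pos (stdCdf_pos t) _)

lemma sum_outcomeProb (t : ℝ) : ∑ b, outcomeProb b t = 1 := by simp [Fin.sum_univ_two]

lemma hasDerivAt_log_outcomeProb (b : Fin 2) (t : ℝ) :
    HasDerivAt (fun x => Real.log (outcomeProb b x)) (logSlope b t) t := by
  have h0 := stdCdf_pos t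
  have h1 := stdCdf_lt_one t
  fin_cases b
  · simpa [logSlope] using (hasDerivAt_stdCdf t).log h0.ne'
  · simpa [logSlope, neg_div] using ((hasDerivAt_stdCdf t).const_sub 1).log (by linarith)

lemma abs_logSlope_le (b : Fin 2) (t : ℝ) : |logSlope b t| ≤ Real.exp 2 * (1 + |t|) := by
  have h0 := stdCdf_pos t
  have h1 : 0 < 1 - stdCdf t := by linarith [stdCdf_lt_one t]
  have hp := stdPdf_pos t
  rw [logSlope]
  split_ifs
  · rw [abs_of_pos (by positivity), div_le_iff₀ h0]
    exact stdPdf_le_stdCdf t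
  · rw [abs_neg, abs_of_pos (by positivity), div_le_iff₀ h1]
    exact stdPdf_le_one_sub_stdCdf t

/-- The negative mean of `logSlope b t * (t - u)` when the true threshold is `u`. -/
def slopeGap (u t : ℝ) : ℝ :=
  stdPdf t / (stdCdf t * (1 - stdCdf t)) * ((t - u) * (stdCdf t - stdCdf u))

/-- Over a common denominator the two outcomes combine to `φ(t) (Φ(u) - Φ(t)) / (Φ(t) (1 - Φ(t)))`,
which opposes the error `t - u`. -/
lemma sum_outcomeProb_mul_logSlope (u t : ℝ) :
    ∑ b, outcomeProb b u * (logSlope b t * (t - u)) = -slopeGap u t := by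
  have h0 := (stdCdf_pos t).ne'
  have h1 : 1 - stdCdf t ≠ 0 := by linarith [stdCdf_lt_one t]
  simp only [Fin.sum_univ_two, outcomeProb_zero, outcomeProb_one, logSlope, slopeGap, if_true,
    one_ne_zero, if_false]
  field_simp
  ring

lemma slopeGap_pos {u t : ℝ} (h : t ≠ u) : 0 < slopeGap u t := by
  have h0 := stdCdf_pos t
  have h1 : 0 < 1 - stdCdf t := by linarith [stdCdf_lt_one t]
  have hp := stdPdf_pos t
  refine mul_pos (by positivity) ?_
  rcases lt_or_gt_of_ne h with h | h
  · exact mul_pos_of_neg_of_neg (by linarith) (by linarith [strictMono_stdCdf h])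
  · exact mul_pos (by linarith) (by linarith [strictMono_stdCdf h])

lemma slopeGap_nonneg (u t : ℝ) : 0 ≤ slopeGap u t := by
  rcases eq_or_ne t u with rfl | h
  · simp [slopeGap]
  · exact (slopeGap_pos h).le

lemma continuous_slopeGap (u : ℝ) : Continuous (slopeGap u) := by
  refine (continuous_stdPdf.div (continuous_stdCdf.mul (continuous_const.sub continuous_stdCdf))
    fun t => ?_).mul ((continuous_id.sub continuous_const).mul
      (continuous_stdCdf.sub continuous_const))
  exact ne_of_gt (mul_pos (stdCdf_pos t) (sub_pos.2 (stdCdf_lt_one t)))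

/-! ### The score -/

variable {n : ℕ}

/-- The vector `(-s, 1)`, whose inner product with `(A_i c_i)` is `c_i - A_i s`. -/
def regressor (s : BinVec n) : RowParam n :=
  WithLp.toLp 2 (Fin.snoc (α := fun _ => ℝ) (fun j => -s.toReal j) 1)

lemma regressor_castSucc (s : BinVec n) (j : Fin n) : regressor s j.castSucc = -s.toReal j := by
  simp [regressor]

lemma regressor_last (s : BinVec n) : regressor s (Fin.last n) = 1 := by simp [regressor]

lemma threshold_eq_sum (ϑ : RowParam n) (s : BinVec n) :
    threshold ϑ s = ∑ j, ϑ j * regressor s j := by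
  rw [Fin.sum_univ_castSucc]
  simp only [regressor_castSucc, regressor_last, threshold, mul_neg, Finset.sum_neg_distrib]
  ring

lemma threshold_eq_inner (ϑ : RowParam n) (s : BinVec n) :
    threshold ϑ s = inner ℝ (regressor s) ϑ := by
  rw [threshold_eq_sum, PiLp.inner_apply]
  simp

lemma abs_regressor_le (s : BinVec n) (j : Fin (n + 1)) : |regressor s j| ≤ 1 := by
  induction j using Fin.lastCases with
  | last => simp [regressor_last]
  | cast j =>
    rw [regressor_castSucc, abs_neg, BinVec.toReal, Nat.abs_cast]
    exact Nat.cast_le_one.2 (Nat.le_of_lt_succ (s j).isLt)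

lemma scoreRow_eq (i : Fin n) (ϑ : RowParam n) (s : BinVec n × BinVec n) :
    scoreRow i ϑ s = logSlope (s.1 i) (threshold ϑ s.2) • regressor s.2 := by
  refine HasGradientAt.gradient ?_
  rw [hasGradientAt_iff_hasFDerivAt]
  have h1 : HasFDerivAt (fun η : RowParam n => threshold η s.2) (innerSL ℝ (regressor s.2)) ϑ := by
    have := (innerSL ℝ (regressor s.2)).hasFDerivAt (x := ϑ)
    refine this.congr_of_eventuallyEq (Eventually.of_forall fun η => ?_)
    simp [threshold_eq_inner]
  -- `likelihood i s η` is definitionally `outcomeProb (s.1 i) (threshold η s.2)`, so this is the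
  -- chain rule for the required function.
  have h2 := (hasDerivAt_log_outcomeProb (s.1 i) (threshold ϑ s.2)).comp_hasFDerivAt ϑ h1
  refine h2.congr_fderiv ?_
  ext v
  simp

lemma score_apply (θ : Param n) (s : BinVec n × BinVec n) (p : Fin n × Fin (n + 1)) :
    score θ s p = logSlope (s.1 p.1) (threshold (block θ p.1) s.2) * regressor s.2 p.2 := by
  simp [score, scoreRow_eq]

lemma threshold_block_sub (θ θ' : Param n) (i : Fin n) (s : BinVec n) :
    threshold (block θ i) s - threshold (block θ' i) s
      = ∑ j, (θ (i, j) - θ' (i, j)) * regressor s j := by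
  simp [threshold_eq_sum, block, sub_mul]

/-- Thresholds are linear in the parameter with gradient `regressor`, so each row contributes only
its scalar threshold error. -/
lemma inner_sub_score (θ θ' : Param n) (s : BinVec n × BinVec n) :
    inner ℝ (θ - θ') (score θ s) = ∑ i, logSlope (s.1 i) (threshold (block θ i) s.2) *
      (threshold (block θ i) s.2 - threshold (block θ' i) s.2) := by
  rw [PiLp.inner_apply, Fintype.sum_prod_type]
  refine Finset.sum_congr rfl fun i _ => ?_
  rw [threshold_block_sub, Finset.mul_sum]
  refine Finset.sum_congr rfl fun j _ => ?_
  simp only [score_apply, PiLp.sub_apply, RCLike.inner_apply, conj_trivial]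
  ring

lemma abs_threshold_block_le (θ : Param n) (i : Fin n) (s : BinVec n) :
    |threshold (block θ i) s| ≤ (n + 1) * ‖θ‖ := by
  rw [threshold_eq_sum]
  calc _ ≤ ∑ j, |block θ i j * regressor s j| := Finset.abs_sum_le_sum_abs _ _
    _ ≤ ∑ _j : Fin (n + 1), ‖θ‖ := by
      refine Finset.sum_le_sum fun j _ => ?_
      rw [abs_mul]
      have h := PiLp.norm_apply_le θ (i, j)
      exact (mul_le_of_le_one_right (abs_nonneg _) (abs_regressor_le s j)).trans h
    _ = _ := by simp

lemma exists_norm_sq_score_le (θ' : Param n) :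
    ∃ C, 0 ≤ C ∧ ∀ θ s, ‖score θ s‖ ^ 2 ≤ C * (1 + ‖θ - θ'‖ ^ 2) := by
  set b : ℝ := 1 + (n + 1) * ‖θ'‖ with hb
  refine ⟨∑ _p : Fin n × Fin (n + 1), Real.exp 2 ^ 2 * (2 * b ^ 2 + 2 * (n + 1) ^ 2),
    Finset.sum_nonneg fun _ _ => by positivity, fun θ s => ?_⟩
  rw [EuclideanSpace.norm_sq_eq, Finset.sum_mul]
  refine Finset.sum_le_sum fun p _ => ?_
  have h1 : ‖score θ s p‖ ≤ Real.exp 2 * (b + (n + 1) * ‖θ - θ'‖) := by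
    rw [score_apply, Real.norm_eq_abs, abs_mul]
    refine (mul_le_of_le_one_right (abs_nonneg _) (abs_regressor_le _ _)).trans
      ((abs_logSlope_le _ _).trans ?_)
    have h := abs_threshold_block_le θ p.1 s.2
    have h' : ‖θ‖ ≤ ‖θ - θ'‖ + ‖θ'‖ := by simpa using norm_add_le (θ - θ') θ'
    refine mul_le_mul_of_nonneg_left ?_ (Real.exp_pos 2).le
    have h2 : ((n : ℝ) + 1) * ‖θ‖ ≤ (n + 1) * (‖θ - θ'‖ + ‖θ'‖) := by gcongr
    rw [hb]
    linarith
  calc _ ≤ (Real.exp 2 * (b + (n + 1) * ‖θ - θ'‖)) ^ 2 := by gcongr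
    _ ≤ Real.exp 2 ^ 2 * (2 * b ^ 2 + 2 * ((n + 1) * ‖θ - θ'‖) ^ 2) := by
      rw [mul_pow]; gcongr; nlinarith [sq_nonneg (b - (n + 1) * ‖θ - θ'‖)]
    _ ≤ Real.exp 2 ^ 2 * ((2 * b ^ 2 + 2 * (n + 1) ^ 2) * (1 + ‖θ - θ'‖ ^ 2)) := by
      gcongr
      have := mul_nonneg (sq_nonneg b) (sq_nonneg ‖θ - θ'‖)
      have := sq_nonneg ((n : ℝ) + 1)
      nlinarith
    _ = _ := by ring

/-! ### Transition probabilities and the mean drift -/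

/-- The probability of moving from `s` to `s'` under the parameter `θ`. -/
def transProb (θ : Param n) (s s' : BinVec n) : ℝ :=
  ∏ i, outcomeProb (s' i) (threshold (block θ i) s)

lemma transProb_pos (θ : Param n) (s s' : BinVec n) : 0 < transProb θ s s' :=
  Finset.prod_pos fun _ _ => outcomeProb_pos _ _

/-- Marginalisation of a product law: absorbing `f` into factor `i` keeps the summand a product, and
every other factor sums to `1`. -/
lemma sum_transProb_mul_apply (θ : Param n) (s : BinVec n) (i : Fin n) (f : Fin 2 → ℝ) :
    ∑ s', transProb θ s s' * f (s' i) = ∑ b, outcomeProb b (threshold (block θ i) s) * f b := by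
  have h : ∀ s' : BinVec n, transProb θ s s' * f (s' i) =
      ∏ j, outcomeProb (s' j) (threshold (block θ j) s) * (if j = i then f (s' j) else 1) := by
    intro s'
    rw [Finset.prod_mul_distrib, Finset.prod_ite_eq']
    simp [transProb]
  simp_rw [h]
  rw [← Fintype.prod_sum (fun j b => outcomeProb b (threshold (block θ j) s) *
    (if j = i then f b else 1)), Finset.prod_eq_single i]
  · simp
  · intro j _ hj
    simp [hj, -Fin.sum_univ_two, sum_outcomeProb]
  · simp

lemma sum_transProb (θ : Param n) (s : BinVec n) : ∑ s', transProb θ s s' = 1 := by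
  have h := Fintype.prod_sum (fun j b => outcomeProb b (threshold (block θ j) s))
  simpa [sum_outcomeProb, transProb] using h.symm

/-- The negative mean drift towards `θ'`, the true parameter, at state `s`. -/
def driftGap (θ' θ : Param n) (s : BinVec n) : ℝ :=
  ∑ i, slopeGap (threshold (block θ' i) s) (threshold (block θ i) s)

lemma sum_transProb_mul_inner_score (θ' θ : Param n) (s : BinVec n) :
    ∑ s', transProb θ' s s' * inner ℝ (θ - θ') (score θ (s', s)) = -driftGap θ' θ s := by
  simp_rw [inner_sub_score, Finset.mul_sum]
  rw [Finset.sum_comm, driftGap, ← Finset.sum_neg_distrib]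
  refine Finset.sum_congr rfl fun i _ => ?_
  rw [← sum_outcomeProb_mul_logSlope, ← sum_transProb_mul_apply]

lemma driftGap_nonneg (θ' θ : Param n) (s : BinVec n) : 0 ≤ driftGap θ' θ s :=
  Finset.sum_nonneg fun _ _ => slopeGap_nonneg _ _

lemma continuous_driftGap (θ' : Param n) (s : BinVec n) : Continuous fun θ => driftGap θ' θ s := by
  refine continuous_finsetSum _ fun i _ => (continuous_slopeGap _).comp ?_
  simp only [threshold_eq_sum, block]
  fun_prop

/-- The states `0, e_1, …, e_n` identify the parameter. -/
lemma eq_of_threshold_eq {θ θ' : Param n}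
    (h : ∀ s i, threshold (block θ i) s = threshold (block θ' i) s) : θ = θ' := by
  have hc : ∀ i, θ (i, Fin.last n) = θ' (i, Fin.last n) := fun i => by
    simpa [threshold, block, BinVec.toReal] using h 0 i
  ext ⟨i, j⟩
  induction j using Fin.lastCases with
  | last => exact hc i
  | cast j =>
    have := h (Pi.single j 1) i
    have hs : ∀ k, BinVec.toReal (Pi.single j 1 : BinVec n) k = if k = j then 1 else 0 := by
      intro k
      by_cases hk : k = j
      · subst hk; simp [BinVec.toReal]
      · simp [BinVec.toReal, hk]
    simp only [threshold, block, hs, mul_ite, mul_one, mul_zero, Finset.sum_ite_eq',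
      Finset.mem_univ, if_true, hc] at this
    linarith

lemma sum_driftGap_pos {θ' θ : Param n} (h : θ ≠ θ') : 0 < ∑ s, driftGap θ' θ s := by
  have : ∃ s i, threshold (block θ i) s ≠ threshold (block θ' i) s := by
    by_contra! hc
    exact h (eq_of_threshold_eq hc)
  obtain ⟨s, i, hs⟩ := this
  exact Finset.sum_pos' (fun s _ => driftGap_nonneg θ' θ s) ⟨s, Finset.mem_univ s,
    Finset.sum_pos' (fun _ _ => slopeGap_nonneg _ _) ⟨i, Finset.mem_univ i, slopeGap_pos hs⟩⟩

/-! ### Finite-state chains -/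

section Chain

variable {Ω α β : Type*}

/-- The trajectory `(S_0, …, S_k)`. -/
def traj (S : ℕ → Ω → α) (k : ℕ) (ω : Ω) : Fin (k + 1) → α := fun j => S j ω

/-- `f` is a function of the trajectory `(S_0, …, S_k)`. -/
def DependsOnTraj (S : ℕ → Ω → α) (k : ℕ) (f : Ω → β) : Prop :=
  Function.FactorsThrough f (traj S k)

lemma traj_eq_of_le {S : ℕ → Ω → α} {k l : ℕ} (h : k ≤ l) {ω ω' : Ω}
    (hω : traj S l ω = traj S l ω') : traj S k ω = traj S k ω' := by
  funext j
  exact congrFun hω ⟨j, by omega⟩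

lemma dependsOnTraj_state (S : ℕ → Ω → α) {k l : ℕ} (h : k ≤ l) : DependsOnTraj S l (S k) :=
  fun _ _ hω => congrFun hω ⟨k, by omega⟩

lemma DependsOnTraj.exists_comp_eq [Nonempty β] {S : ℕ → Ω → α} {k : ℕ} {f : Ω → β}
    (hf : DependsOnTraj S k f) : ∃ F : (Fin (k + 1) → α) → β, f = F ∘ traj S k :=
  (Function.factorsThrough_iff _).1 hf

lemma measurable_traj [MeasurableSpace Ω] [MeasurableSpace α] {S : ℕ → Ω → α}
    (hS : ∀ k, Measurable (S k)) (k : ℕ) : Measurable (traj S k) :=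
  measurable_pi_iff.2 fun j => hS j

variable [Fintype α] {S : ℕ → Ω → α}

/-- The innovation `G(S_{k+1}) - E[G(S_{k+1}) | S_0, …, S_k]`. -/
def innovation (S : ℕ → Ω → α) (q : α → α → ℝ) (G : ℕ → Ω → α → ℝ) (k : ℕ) (ω : Ω) : ℝ :=
  G k ω (S (k + 1) ω) - ∑ s, q (S k ω) s * G k ω s

lemma dependsOnTraj_innovation {q : α → α → ℝ} {G : ℕ → Ω → α → ℝ} {k : ℕ}
    (hG : DependsOnTraj S k (G k)) : DependsOnTraj S (k + 1) (innovation S q G k) := by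
  intro ω ω' h
  simp only [innovation, hG (traj_eq_of_le k.le_succ h), dependsOnTraj_state S le_rfl h,
    dependsOnTraj_state S k.le_succ h]

lemma abs_innovation_le {q : α → α → ℝ} (hq0 : ∀ s s', 0 ≤ q s s') (hq1 : ∀ s, ∑ s', q s s' = 1)
    {G : ℕ → Ω → α → ℝ} {C : ℝ} (hC : ∀ k ω s, |G k ω s| ≤ C) (k : ℕ) (ω : Ω) :
    |innovation S q G k ω| ≤ 2 * C := by
  have h : |∑ s, q (S k ω) s * G k ω s| ≤ C := by
    calc _ ≤ ∑ s, |q (S k ω) s * G k ω s| := Finset.abs_sum_le_sum_abs _ _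
      _ ≤ ∑ s, q (S k ω) s * C := by
        refine Finset.sum_le_sum fun s _ => ?_
        rw [abs_mul, abs_of_nonneg (hq0 _ _)]
        exact mul_le_mul_of_nonneg_left (hC k ω s) (hq0 _ _)
      _ = C := by rw [← Finset.sum_mul, hq1, one_mul]
  have := abs_sub (G k ω (S (k + 1) ω)) (∑ s, q (S k ω) s * G k ω s)
  rw [innovation]
  linarith [hC k ω (S (k + 1) ω)]

variable [MeasurableSpace α] [DiscreteMeasurableSpace α] [MeasurableSpace Ω]

/-- The filtration generated by the trajectories. -/
def trajFiltration (hS : ∀ k, Measurable (S k)) :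
    Filtration ℕ (inferInstance : MeasurableSpace Ω) where
  seq k := MeasurableSpace.comap (traj S k) inferInstance
  mono' k l h := by
    rw [← measurable_iff_comap_le]
    have : traj S k = (fun (p : Fin (l + 1) → α) (j : Fin (k + 1)) => p ⟨j, by omega⟩) ∘ traj S l :=
      rfl
    rw [this]
    exact (measurable_pi_iff.2 fun j => measurable_pi_apply _).comp (comap_measurable _)
  le' k := (measurable_traj hS k).comap_le

/-- Trajectories take values in a finite discrete space, so factoring through them already gives
measurability; integrability follows likewise. -/
lemma DependsOnTraj.stronglyMeasurable (hS : ∀ k, Measurable (S k)) {k : ℕ} {f : Ω → ℝ}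
    (hf : DependsOnTraj S k f) : StronglyMeasurable[trajFiltration hS k] f := by
  obtain ⟨F, rfl⟩ := hf.exists_comp_eq
  exact (Measurable.of_discrete.comp (comap_measurable _)).stronglyMeasurable

lemma DependsOnTraj.integrable (hS : ∀ k, Measurable (S k)) {P : Measure Ω} [IsFiniteMeasure P]
    {k : ℕ} {f : Ω → ℝ} (hf : DependsOnTraj S k f) : Integrable f P := by
  obtain ⟨F, rfl⟩ := hf.exists_comp_eq
  refine Integrable.comp_measurable ?_ (measurable_traj hS k)
  exact Integrable.of_finite

/-- `S` is a Markov chain with transition probabilities `q`. -/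
def HasTransProb (P : Measure Ω) (S : ℕ → Ω → α) (q : α → α → ℝ) : Prop :=
  ∀ (k : ℕ) (p : Fin (k + 1) → α) (s : α),
    P.real {ω | traj S k ω = p ∧ S (k + 1) ω = s} =
      P.real {ω | traj S k ω = p} * q (p (Fin.last k)) s

lemma HasTransProb.integral_eq (hS : ∀ k, Measurable (S k)) {P : Measure Ω} [IsFiniteMeasure P]
    {q : α → α → ℝ} (hq : HasTransProb P S q) {k : ℕ} {G : Ω → α → ℝ}
    (hG : DependsOnTraj S k G) :
    ∫ ω, G ω (S (k + 1) ω) ∂P = ∫ ω, ∑ s, q (S k ω) s * G ω s ∂P := by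
  obtain ⟨F, rfl⟩ := hG.exists_comp_eq
  have hm := (measurable_traj hS k)
  have h1 : ∫ ω, F (traj S k ω) (S (k + 1) ω) ∂P =
      ∫ x : (Fin (k + 1) → α) × α, F x.1 x.2
        ∂(P.map fun ω => (traj S k ω, S (k + 1) ω)) := by
    rw [integral_map (hm.prodMk (hS _)).aemeasurable
      (Measurable.of_discrete.aestronglyMeasurable)]
  have h2 : ∫ ω, ∑ s, q (S k ω) s * F (traj S k ω) s ∂P =
      ∫ p : Fin (k + 1) → α, ∑ s, q (p (Fin.last k)) s * F p s ∂(P.map (traj S k)) := by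
    rw [integral_map hm.aemeasurable (Measurable.of_discrete.aestronglyMeasurable)]
    rfl
  simp only [Function.comp_apply]
  rw [h1, h2, integral_fintype Integrable.of_finite, integral_fintype Integrable.of_finite,
    Fintype.sum_prod_type]
  refine Finset.sum_congr rfl fun p _ => ?_
  rw [smul_eq_mul, Finset.mul_sum]
  refine Finset.sum_congr rfl fun s _ => ?_
  rw [map_measureReal_apply (hm.prodMk (hS _)) (measurableSet_singleton _),
    map_measureReal_apply hm (measurableSet_singleton _)]
  have := hq k p s
  have e1 : (fun ω => (traj S k ω, S (k + 1) ω)) ⁻¹' {(p, s)} =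
    {ω | traj S k ω = p ∧ S (k + 1) ω = s} := by ext; simp
  have e2 : traj S k ⁻¹' {p} = {ω | traj S k ω = p} := rfl
  rw [e1, e2, this, smul_eq_mul]
  ring

/-- Innovations are orthogonal to the past. Indicators `f` give the martingale property, partial
sums `f` kill the cross terms in the second moment. -/
lemma HasTransProb.integral_mul_innovation (hS : ∀ k, Measurable (S k)) {P : Measure Ω}
    [IsFiniteMeasure P] {q : α → α → ℝ} (hq : HasTransProb P S q) {G : ℕ → Ω → α → ℝ} {k : ℕ}
    (hG : DependsOnTraj S k (G k)) {f : Ω → ℝ} (hf : DependsOnTraj S k f) :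
    ∫ ω, f ω * innovation S q G k ω ∂P = 0 := by
  have hfG : DependsOnTraj S k fun ω s => f ω * G k ω s := fun ω ω' h => by
    simp only [hf h, hG h]
  have h1 : DependsOnTraj S (k + 1) fun ω => f ω * G k ω (S (k + 1) ω) := fun ω ω' h => by
    simp only [hf (traj_eq_of_le k.le_succ h), hG (traj_eq_of_le k.le_succ h),
      dependsOnTraj_state S le_rfl h]
  have h2 : DependsOnTraj S k fun ω => ∑ s, q (S k ω) s * (f ω * G k ω s) := fun ω ω' h => by
    simp only [hf h, hG h, dependsOnTraj_state S le_rfl h]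
  have := hq.integral_eq hS hfG
  rw [← sub_eq_zero, ← integral_sub (h1.integrable hS) (h2.integrable hS)] at this
  rw [← this]
  congr 1 with ω
  rw [innovation, mul_sub, Finset.mul_sum]
  congr 1
  exact Finset.sum_congr rfl fun s _ => by ring

/-- Square-summable weighted series of bounded innovations converge almost surely. -/
theorem HasTransProb.ae_tendsto_sum_innovation (hS : ∀ k, Measurable (S k)) {P : Measure Ω}
    [IsProbabilityMeasure P] {q : α → α → ℝ} (hq : HasTransProb P S q)
    (hq0 : ∀ s s', 0 ≤ q s s') (hq1 : ∀ s, ∑ s', q s s' = 1)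
    {G : ℕ → Ω → α → ℝ} (hG : ∀ k, DependsOnTraj S k (G k)) {C : ℝ}
    (hC : ∀ k ω s, |G k ω s| ≤ C) {b : ℕ → ℝ} (hb : Summable fun k => b k ^ 2) :
    ∀ᵐ ω ∂P, ∃ l, Tendsto (fun m => ∑ k ∈ Finset.range m, b k * innovation S q G k ω)
      atTop (𝓝 l) := by
  set X := innovation S q G with hX
  set N : ℕ → Ω → ℝ := fun m ω => ∑ k ∈ Finset.range m, b k * X k ω with hN
  have hXdep : ∀ k, DependsOnTraj S (k + 1) (X k) := fun k => dependsOnTraj_innovation (hG k)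
  have hNdep : ∀ m, DependsOnTraj S m (N m) := fun m ω ω' h =>
    Finset.sum_congr rfl fun k hk => by
      rw [hXdep k (traj_eq_of_le (Finset.mem_range.1 hk) h)]
  have hNsucc : ∀ m ω, N (m + 1) ω = N m ω + b m * X m ω := fun m ω => Finset.sum_range_succ _ _
  have hmart : Martingale N (trajFiltration hS) P := by
    refine martingale_nat (fun m => (hNdep m).stronglyMeasurable hS)
      (fun m => (hNdep m).integrable hS) fun m => ?_
    refine ae_eq_condExp_of_forall_setIntegral_eq ((trajFiltration hS).le m)
      ((hNdep (m + 1)).integrable hS) (fun _ _ _ => ((hNdep m).integrable hS).integrableOn)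
      (fun s hs _ => ?_) ((hNdep m).stronglyMeasurable hS).aestronglyMeasurable
    have hs' := (trajFiltration hS).le m s hs
    have hind : DependsOnTraj S m (s.indicator fun _ => b m) := by
      obtain ⟨t, _, rfl⟩ := hs
      intro ω ω' h
      have h' : ω ∈ traj S m ⁻¹' t ↔ ω' ∈ traj S m ⁻¹' t := by rw [Set.mem_preimage, h]; rfl
      by_cases hω : ω ∈ traj S m ⁻¹' t
      · rw [Set.indicator_of_mem hω, Set.indicator_of_mem (h'.1 hω)]
      · rw [Set.indicator_of_notMem hω, Set.indicator_of_notMem (mt h'.2 hω)]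
    have h0 := hq.integral_mul_innovation hS (hG m) hind
    have h1 : ∫ ω in s, b m * X m ω ∂P = 0 := by
      rw [← integral_indicator hs', ← h0]
      congr 1 with ω
      by_cases hω : ω ∈ s <;> simp [hω, hX]
    simp_rw [hNsucc m]
    rw [integral_add ((hNdep m).integrable hS).integrableOn
      (((hXdep m).integrable hS).const_mul _).integrableOn, h1, add_zero]
  have hL2 : ∀ m, ∫ ω, N m ω ^ 2 ∂P ≤ ∑ k ∈ Finset.range m, b k ^ 2 * (2 * C) ^ 2 := by
    intro m
    induction m with
    | zero => simp [hN]
    | succ m ih =>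
      have i1 : Integrable (fun ω => N m ω ^ 2) P :=
        DependsOnTraj.integrable hS (k := m) fun ω ω' h => by simp only [hNdep m h]
      have i2 : Integrable (fun ω => N m ω * X m ω) P :=
        DependsOnTraj.integrable hS (k := m + 1) fun ω ω' h => by
          simp only [hNdep m (traj_eq_of_le m.le_succ h), hXdep m h]
      have i3 : Integrable (fun ω => X m ω ^ 2) P :=
        DependsOnTraj.integrable hS (k := m + 1) fun ω ω' h => by simp only [hXdep m h]
      have e : ∀ ω, N (m + 1) ω ^ 2 =
          N m ω ^ 2 + 2 * b m * (N m ω * X m ω) + b m ^ 2 * X m ω ^ 2 := fun ω => by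
        rw [hNsucc]; ring
      have h3 : ∫ ω, X m ω ^ 2 ∂P ≤ (2 * C) ^ 2 := by
        calc _ ≤ ∫ _, (2 * C) ^ 2 ∂P := by
              refine integral_mono i3 (integrable_const _) fun ω => ?_
              have h := abs_le.1 (abs_innovation_le (S := S) hq0 hq1 hC m ω)
              exact sq_le_sq' h.1 h.2
          _ = _ := by simp
      have i12 : Integrable (fun ω => N m ω ^ 2 + 2 * b m * (N m ω * X m ω)) P :=
        i1.add (i2.const_mul _)
      simp_rw [e]
      rw [integral_add i12 (i3.const_mul _),
        integral_add i1 (i2.const_mul _), integral_const_mul, integral_const_mul,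
        hq.integral_mul_innovation hS (hG m) (hNdep m), Finset.sum_range_succ, mul_zero, add_zero]
      gcongr
  -- The extra `1` comes from `|x| ≤ x ^ 2 + 1`, which turns the `L²` bound into an `L¹` bound.
  set B : ℝ := (∑' k, b k ^ 2) * (2 * C) ^ 2 + 1 with hB
  have hL1 : ∀ m, eLpNorm (N m) 1 P ≤ (B.toNNReal : ENNReal) := by
    intro m
    have hi := (hNdep m).integrable hS (P := P)
    rw [eLpNorm_one_eq_lintegral_enorm, ← ofReal_integral_norm_eq_lintegral_enorm hi]
    refine ENNReal.ofReal_le_ofReal ?_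
    have i1 : Integrable (fun ω => N m ω ^ 2) P :=
      DependsOnTraj.integrable hS (k := m) fun ω ω' h => by simp only [hNdep m h]
    calc ∫ ω, ‖N m ω‖ ∂P ≤ ∫ ω, (N m ω ^ 2 + 1) ∂P := by
          refine integral_mono hi.norm (i1.add (integrable_const _)) fun ω => ?_
          simp only [Real.norm_eq_abs]
          rw [← sq_abs]
          nlinarith [sq_nonneg (|N m ω| - 1), abs_nonneg (N m ω)]
      _ = ∫ ω, N m ω ^ 2 ∂P + 1 := by
          rw [integral_add i1 (integrable_const _)]; simp
      _ ≤ B := by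
          rw [hB]
          refine add_le_add_left ((hL2 m).trans ?_) 1
          rw [← Finset.sum_mul]
          gcongr
          exact hb.sum_le_tsum _ fun _ _ => sq_nonneg _
  exact hmart.submartingale.exists_ae_tendsto_of_bdd hL1

end Chain

/-! ### The observed chain -/

section System

variable {n : ℕ} {Ω : Type*}

/-- The set of disturbances that lead to the outcome `b` when the threshold is `t`. -/
def outcomeSet (b : Fin 2) (t : ℝ) : Set ℝ := if b = 0 then Set.Iio t else Set.Ici t

lemma measurableSet_outcomeSet (b : Fin 2) (t : ℝ) : MeasurableSet (outcomeSet b t) := by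
  rw [outcomeSet]; split_ifs <;> measurability

lemma gaussianReal_real_outcomeSet (b : Fin 2) (t : ℝ) :
    (gaussianReal 0 1).real (outcomeSet b t) = outcomeProb b t := by
  have h := nullSingletonClass_gaussianReal (μ := 0) (v := 1) one_ne_zero
  have h0 : (gaussianReal 0 1).real (Set.Iio t) = stdCdf t := by
    rw [stdCdf, cdf_eq_real]
    exact measureReal_congr Iio_ae_eq_Iic
  fin_cases b
  · simpa [outcomeSet] using h0
  · have := probReal_compl_eq_one_sub (μ := gaussianReal 0 1) (measurableSet_Iio (a := t))
    rw [Set.compl_Iio, h0] at this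
    simpa [outcomeSet] using this

lemma threshold_block_vec (A : Matrix (Fin n) (Fin n) ℝ) (c : Fin n → ℝ) (i : Fin n)
    (s : BinVec n) : threshold (block (vec A c) i) s = c i - A.mulVec s.toReal i := by
  simp [threshold, block, vec, Matrix.mulVec, dotProduct]

variable {A : Matrix (Fin n) (Fin n) ℝ} {c : Fin n → ℝ} {D Y : ℕ → Ω → Fin n → ℝ}
  {S : ℕ → Ω → BinVec n}

lemma IsSystem.apply_succ_eq_iff (hsys : IsSystem A c D Y S) (k : ℕ) (ω : Ω) (i : Fin n)
    (b : Fin 2) : S (k + 1) ω i = b ↔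
      D k ω i ∈ outcomeSet b (threshold (block (vec A c) i) (S k ω)) := by
  rw [hsys.obs (k + 1), hsys.state, threshold_block_vec, quantizer, outcomeSet]
  simp only [Pi.add_apply]
  fin_cases b
  · by_cases h : c i ≤ A.mulVec (S k ω).toReal i + D k ω i
    · simp [h]; linarith
    · simp [h]; linarith
  · by_cases h : c i ≤ A.mulVec (S k ω).toReal i + D k ω i
    · simp [h]; linarith
    · simp [h]; linarith

/-- Along a prescribed path the thresholds are constants, so the event is a rectangle in the
disturbances intersected with an initial event; independence then applies without conditioning. -/
lemma IsSystem.cylinder_eq (hsys : IsSystem A c D Y S) (s : ℕ → BinVec n) (k : ℕ) :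
    {ω | ∀ j ≤ k, S j ω = s j} =
      (⋂ p ∈ Finset.range k ×ˢ (Finset.univ : Finset (Fin n)), (fun ω => D p.1 ω p.2) ⁻¹'
        outcomeSet (s (p.1 + 1) p.2) (threshold (block (vec A c) p.2) (s p.1))) ∩
      S 0 ⁻¹' {s 0} := by
  ext ω
  simp only [Set.mem_ofPred_eq, Set.mem_inter_iff, Set.mem_iInter, Finset.mem_product,
    Finset.mem_range, Finset.mem_univ, and_true, Set.mem_preimage, Set.mem_singleton_iff]
  constructor
  · intro h
    refine ⟨fun p hp => ?_, h 0 (Nat.zero_le _)⟩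
    rw [← h p.1 hp.le, ← hsys.apply_succ_eq_iff, h (p.1 + 1) hp]
  · rintro ⟨h, h0⟩ j
    induction j with
    | zero => exact fun _ => h0
    | succ j ih =>
      intro hj
      funext i
      rw [hsys.apply_succ_eq_iff, ih (by omega)]
      exact h (j, i) hj

variable [MeasurableSpace Ω] {P : Measure Ω}

lemma IsSystem.measurable_state (hsys : IsSystem A c D Y S) (hY : Measurable (Y 0))
    (hD : GaussianDisturbances P D (S 0)) (k : ℕ) : Measurable (S k) := by
  have hq : ∀ {y : Ω → Fin n → ℝ}, Measurable y → Measurable fun ω => quantizer (y ω) c := by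
    intro y hy
    refine measurable_pi_iff.2 fun i => ?_
    exact Measurable.ite (measurableSet_le measurable_const ((measurable_pi_apply i).comp hy))
      measurable_const measurable_const
  induction k with
  | zero => rw [show S 0 = _ from funext (hsys.obs 0)]; exact hq hY
  | succ k ih =>
    rw [show S (k + 1) = _ from funext (hsys.obs (k + 1))]
    refine hq ?_
    rw [show Y (k + 1) = _ from funext (hsys.state k)]
    have h1 : Measurable fun s : BinVec n => A.mulVec s.toReal := Measurable.of_discrete
    exact (h1.comp ih).add (measurable_pi_iff.2 fun i => hD.measurable k i)

lemma IsSystem.measureReal_cylinder [IsProbabilityMeasure P] (hsys : IsSystem A c D Y S)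
    (hD : GaussianDisturbances P D (S 0)) (s : ℕ → BinVec n) (k : ℕ) :
    P.real {ω | ∀ j ≤ k, S j ω = s j} =
      (∏ j ∈ Finset.range k, transProb (vec A c) (s j) (s (j + 1))) * P.real (S 0 ⁻¹' {s 0}) := by
  set B : ℕ × Fin n → Set ℝ := fun p =>
    outcomeSet (s (p.1 + 1) p.2) (threshold (block (vec A c) p.2) (s p.1)) with hB
  have hBm : ∀ p, MeasurableSet (B p) := fun p => measurableSet_outcomeSet _ _
  set I := Finset.range k ×ˢ (Finset.univ : Finset (Fin n))
  have hT : MeasurableSet (⋂ p ∈ I, (fun d : ℕ × Fin n → ℝ => d p) ⁻¹' B p) :=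
    Finset.measurableSet_biInter I fun p _ => measurable_pi_apply p (hBm p)
  have h1 := hD.indep_init.measure_inter_preimage_eq_mul _ _ hT (measurableSet_singleton (s 0))
  have h2 := hD.indep.measure_inter_preimage_eq_mul I (sets := B) fun p _ => hBm p
  have h3 : (fun (ω : Ω) (p : ℕ × Fin n) => D p.1 ω p.2) ⁻¹'
      (⋂ p ∈ I, (fun d : ℕ × Fin n → ℝ => d p) ⁻¹' B p) =
      ⋂ p ∈ I, (fun ω => D p.1 ω p.2) ⁻¹' B p := by
    simp only [Set.preimage_iInter]
    rfl
  rw [h3, h2] at h1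
  have h4 : ∀ p : ℕ × Fin n, (P ((fun ω => D p.1 ω p.2) ⁻¹' B p)).toReal =
      outcomeProb (s (p.1 + 1) p.2) (threshold (block (vec A c) p.2) (s p.1)) := fun p => by
    rw [← gaussianReal_real_outcomeSet, ← hD.law p.1 p.2, measureReal_def,
      Measure.map_apply (hD.measurable _ _) (hBm p)]
  rw [measureReal_def, hsys.cylinder_eq, h1, ENNReal.toReal_mul, ENNReal.toReal_prod,
    measureReal_def]
  simp_rw [h4]
  rw [Finset.prod_product]
  rfl

lemma IsSystem.hasTransProb [IsProbabilityMeasure P] (hsys : IsSystem A c D Y S)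
    (hD : GaussianDisturbances P D (S 0)) : HasTransProb P S (transProb (vec A c)) := by
  intro k p s'
  -- Extending `p` by `s'` makes both events cylinders of one path, whose probabilities differ by
  -- the last factor.
  set s : ℕ → BinVec n := fun j => if h : j < k + 1 then p ⟨j, h⟩ else s' with hs
  have hlast : s (k + 1) = s' := by simp [hs]
  have hk : s k = p (Fin.last k) := by simp [hs]; rfl
  have h1 : {ω | traj S k ω = p} = {ω | ∀ j ≤ k, S j ω = s j} := by
    ext ω
    simp only [Set.mem_ofPred_eq, funext_iff (f := traj S k ω), Fin.forall_iff, traj]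
    refine forall_congr' fun j => ⟨fun h hj => ?_, fun h hj => ?_⟩
    · rw [h (by omega), hs]; simp [Nat.lt_succ_of_le hj]
    · rw [h (by omega), hs]; simp [hj]
  have h2 : {ω | traj S k ω = p ∧ S (k + 1) ω = s'} = {ω | ∀ j ≤ k + 1, S j ω = s j} := by
    ext ω
    have := Set.ext_iff.1 h1 ω
    simp only [Set.mem_ofPred_eq] at this ⊢
    rw [this, ← hlast]
    refine ⟨fun h j hj => ?_, fun h => ⟨fun j hj => h j (by omega), h _ le_rfl⟩⟩
    rcases Nat.le_succ_iff.1 hj with hj | rfl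
    exacts [h.1 j hj, h.2]
  rw [h1, h2, hsys.measureReal_cylinder hD, hsys.measureReal_cylinder hD,
    Finset.prod_range_succ, hlast, hk]
  ring

end System

/-! ### Pathwise analysis of the recursions -/

section Pathwise

variable {E : Type*} [NormedAddCommGroup E] [InnerProductSpace ℝ E]

lemma norm_sq_step (x x' κ : E) (a : ℝ) :
    ‖x + a • κ - x'‖ ^ 2 =
      ‖x - x'‖ ^ 2 + 2 * a * inner ℝ (x - x') κ + a ^ 2 * ‖κ‖ ^ 2 := by
  rw [show x + a • κ - x' = (x - x') + a • κ by abel, norm_add_sq_real, inner_smul_right,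
    norm_smul, mul_pow, Real.norm_eq_abs, sq_abs]
  ring

/-- With `W = 1 + ‖x - x'‖ ^ 2`, one step multiplies `W` by at most `1 + y ≤ exp y`, where `y` is
twice the noise normalised by `W` plus `C * a ^ 2`. These exponents have bounded partial sums.
Normalising by `W` is what avoids an a priori bound on `x`. -/
lemma bounded_of_step {x κ : ℕ → E} {x' : E} {a ζ : ℕ → ℝ} {C : ℝ} (hC : 0 ≤ C)
    (ha : ∀ k, 0 < a k) (ha2 : Summable fun k => a k ^ 2)
    (hstep : ∀ k, x (k + 1) = x k + a k • κ k)
    (hκ : ∀ k, ‖κ k‖ ^ 2 ≤ C * (1 + ‖x k - x'‖ ^ 2))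
    (hζ : ∀ k, inner ℝ (x k - x') (κ k) ≤ ζ k)
    (hconv : ∃ l, Tendsto
      (fun m => ∑ k ∈ Finset.range m, a k * ((1 + ‖x k - x'‖ ^ 2)⁻¹ * ζ k)) atTop (𝓝 l)) :
    ∃ R : ℕ, ∀ k, ‖x k - x'‖ ^ 2 ≤ R := by
  obtain ⟨l, hl⟩ := hconv
  obtain ⟨b, hb⟩ := hl.bddAbove_range
  set W : ℕ → ℝ := fun k => 1 + ‖x k - x'‖ ^ 2 with hW
  have hWpos : ∀ k, 0 < W k := fun k => by positivity
  have hone : ∀ k, W (k + 1) ≤ W k * Real.exp (2 * (a k * ((W k)⁻¹ * ζ k)) + C * a k ^ 2) := by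
    intro k
    have h1 : W (k + 1) ≤ W k * (2 * (a k * ((W k)⁻¹ * ζ k)) + C * a k ^ 2 + 1) := by
      have h2 : W k * (2 * (a k * ((W k)⁻¹ * ζ k)) + C * a k ^ 2 + 1) =
          W k + 2 * a k * ζ k + a k ^ 2 * (C * W k) := by
        have := (hWpos k).ne'
        field_simp
        ring
      rw [h2]
      simp only [hW, hstep, norm_sq_step]
      have h3 := mul_le_mul_of_nonneg_left (hζ k) (by linarith [ha k] : 0 ≤ 2 * a k)
      have h4 := mul_le_mul_of_nonneg_left (hκ k) (sq_nonneg (a k))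
      linarith
    exact h1.trans (mul_le_mul_of_nonneg_left (Real.add_one_le_exp _) (hWpos k).le)
  have hall : ∀ m, W m ≤ W 0 * Real.exp
      (2 * (∑ k ∈ Finset.range m, a k * ((W k)⁻¹ * ζ k)) +
        C * ∑ k ∈ Finset.range m, a k ^ 2) := by
    intro m
    induction m with
    | zero => simp
    | succ m ih =>
      refine (hone m).trans ((mul_le_mul_of_nonneg_right ih (Real.exp_pos _).le).trans_eq ?_)
      rw [mul_assoc, ← Real.exp_add, Finset.sum_range_succ, Finset.sum_range_succ]
      ring_nf
  obtain ⟨R, hR⟩ := exists_nat_ge (W 0 * Real.exp (2 * b + C * ∑' k, a k ^ 2))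
  refine ⟨R, fun m => ?_⟩
  have h1 : W m ≤ W 0 * Real.exp (2 * b + C * ∑' k, a k ^ 2) := by
    refine (hall m).trans ?_
    have h2 := hb ⟨m, rfl⟩
    have h3 := ha2.sum_le_tsum (Finset.range m) fun _ _ => sq_nonneg _
    have := hWpos 0
    gcongr
  simp only [hW] at h1 hR
  linarith

/-- Infinitely many truncations would send the level to infinity. After a late reset to `0`, the
remaining noise and second-order terms are too small to drive the path out of a fixed ball around
`x'`, and the level exceeds that ball: no further truncation can occur. -/
lemma finite_truncations {x κ : ℕ → E} {x' : E} {a ζ M : ℕ → ℝ} {σ : ℕ → ℕ} {C : ℝ}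
    (hC : 0 ≤ C) (ha : ∀ k, 0 < a k) (ha2 : Summable fun k => a k ^ 2)
    (hM : Tendsto M atTop atTop)
    (hstep : ∀ k, x (k + 1) =
      if ‖x k + a k • κ k‖ ≤ M (σ k) then x k + a k • κ k else 0)
    (hσ : ∀ k, σ k = ∑ i ∈ Finset.Ico 1 k, if M (σ i) < ‖x i + a i • κ i‖ then 1 else 0)
    (hκ : ∀ k, ‖κ k‖ ^ 2 ≤ C * (1 + ‖x k - x'‖ ^ 2))
    (hζ : ∀ k, inner ℝ (x k - x') (κ k) ≤ ζ k)
    (hconv : ∀ R : ℕ, ∃ l, Tendsto (fun m => ∑ k ∈ Finset.range m,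
      a k * ((if ‖x k - x'‖ ^ 2 ≤ R then 1 else 0) * ζ k)) atTop (𝓝 l)) :
    {k | M (σ k) < ‖x k + a k • κ k‖}.Finite := by
  by_contra hinf
  have hinf : {k | M (σ k) < ‖x k + a k • κ k‖}.Infinite := hinf
  have hσsucc : ∀ k, 1 ≤ k →
      σ (k + 1) = σ k + if M (σ k) < ‖x k + a k • κ k‖ then 1 else 0 := fun k hk => by
    rw [hσ (k + 1), Finset.sum_Ico_succ_top hk, ← hσ k]
  have hσmono : Monotone σ := by
    refine monotone_nat_of_le_succ fun k => ?_
    rcases Nat.eq_zero_or_pos k with rfl | hk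
    · rw [hσ 0]; simp
    · rw [hσsucc k hk]; exact Nat.le_add_right _ _
  have hσtop : Tendsto σ atTop atTop := by
    refine tendsto_atTop_atTop_of_monotone hσmono fun J => ?_
    induction J with
    | zero => exact ⟨0, Nat.zero_le _⟩
    | succ J ih =>
      obtain ⟨k, hk⟩ := ih
      obtain ⟨t, ht, hkt⟩ := hinf.exists_gt k
      refine ⟨t + 1, ?_⟩
      rw [hσsucc t (by omega), if_pos (show M (σ t) < _ from ht)]
      have := hσmono hkt.le
      omega
  -- The reset point is at squared distance `‖x'‖ ^ 2`; the slack `1` covers the tails, at most `2 *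
  -- (1 / 4) + 1 / 4`.
  obtain ⟨R, hR⟩ := exists_nat_ge (‖x'‖ ^ 2 + 1)
  obtain ⟨l, hl⟩ := hconv R
  set T : ℕ → ℝ := fun m => ∑ k ∈ Finset.range m,
    a k * ((if ‖x k - x'‖ ^ 2 ≤ R then 1 else 0) * ζ k) with hT
  set Q : ℕ → ℝ := fun m => ∑ k ∈ Finset.range m, C * (1 + R) * a k ^ 2 with hQ
  have hQl := (ha2.mul_left (C * (1 + R))).hasSum.tendsto_sum_nat
  obtain ⟨N₁, hN₁⟩ := Metric.cauchySeq_iff.1 hl.cauchySeq (1 / 4) (by norm_num)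
  obtain ⟨N₂, hN₂⟩ := Metric.cauchySeq_iff.1 hQl.cauchySeq (1 / 4) (by norm_num)
  obtain ⟨N₃, hN₃⟩ := eventually_atTop.1
    ((hM.comp hσtop).eventually_ge_atTop (1 + R + ‖x'‖))
  obtain ⟨t, ht, htN⟩ := hinf.exists_gt (max N₁ (max N₂ N₃))
  simp only [max_lt_iff] at htN
  obtain ⟨ht1, ht2, ht3⟩ := htN
  have hx0 : x (t + 1) = 0 := by
    rw [hstep, if_neg (not_le.2 ht)]
  have hsmall : ∀ j, t + 1 ≤ j → ‖x'‖ ^ 2 + 2 * (T j - T (t + 1)) + (Q j - Q (t + 1)) ≤ R := by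
    intro j hj
    have h1 := (abs_lt.1 (hN₁ j (by omega) (t + 1) (by omega))).2
    have h2 := (abs_lt.1 (hN₂ j (by omega) (t + 1) (by omega))).2
    linarith
  -- Inside the ball the cutoff in `T` equals `1`, so `T` records the true noise. The bound is on
  -- the update before truncation, so the truncation test is passed.
  have hstay : ∀ j, t + 1 ≤ j →
      ‖x j - x'‖ ^ 2 ≤ ‖x'‖ ^ 2 + 2 * (T j - T (t + 1)) + (Q j - Q (t + 1)) →
      ‖x j + a j • κ j - x'‖ ^ 2 ≤
          ‖x'‖ ^ 2 + 2 * (T (j + 1) - T (t + 1)) + (Q (j + 1) - Q (t + 1)) ∧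
        ‖x j + a j • κ j‖ ≤ M (σ j) := by
    intro j hj hV
    have hVR := hV.trans (hsmall j hj)
    have hbound : ‖x j + a j • κ j - x'‖ ^ 2 ≤
        ‖x'‖ ^ 2 + 2 * (T (j + 1) - T (t + 1)) + (Q (j + 1) - Q (t + 1)) := by
      have hT1 : T (j + 1) = T j + a j * ζ j := by
        simp only [hT, Finset.sum_range_succ, if_pos hVR, one_mul]
      have hQ1 : Q (j + 1) = Q j + C * (1 + R) * a j ^ 2 := Finset.sum_range_succ _ _
      rw [norm_sq_step, hT1, hQ1]
      have h3 := mul_le_mul_of_nonneg_left (hζ j) (by linarith [ha j] : 0 ≤ 2 * a j)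
      have h4 : ‖κ j‖ ^ 2 ≤ C * (1 + R) := (hκ j).trans (by gcongr)
      have h5 := mul_le_mul_of_nonneg_left h4 (sq_nonneg (a j))
      linarith
    refine ⟨hbound, ?_⟩
    have h6 := hbound.trans (hsmall (j + 1) (by omega))
    have h7 : ‖x j + a j • κ j - x'‖ ≤ 1 + R := by
      nlinarith [sq_nonneg (‖x j + a j • κ j - x'‖ - 1)]
    have h8 : ‖x j + a j • κ j‖ ≤ ‖x j + a j • κ j - x'‖ + ‖x'‖ := by
      simpa using norm_add_le (x j + a j • κ j - x') x'
    have h9 : 1 + (R : ℝ) + ‖x'‖ ≤ M (σ j) := hN₃ j (by omega)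
    linarith
  have hall : ∀ j, t + 1 ≤ j →
      ‖x j - x'‖ ^ 2 ≤ ‖x'‖ ^ 2 + 2 * (T j - T (t + 1)) + (Q j - Q (t + 1)) := by
    intro j hj
    induction j, hj using Nat.le_induction with
    | base => simp [hx0]
    | succ j hj ih =>
      obtain ⟨h1, h2⟩ := hstay j hj ih
      rw [hstep, if_pos h2]
      exact h1
  obtain ⟨j, hj, htj⟩ := hinf.exists_gt t
  exact absurd hj (not_lt.2 (hstay j htj (hall j htj)).2)

/-- Removing noise and second-order terms from `‖x - x'‖ ^ 2` leaves an eventually nonincreasing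
sequence, so the distance converges. A positive limit would keep the total gap above some `δ`, and
divergence of `∑ a` would force unbounded decrease. -/
lemma tendsto_of_step [FiniteDimensional ℝ E] {α : Type*} [Fintype α] {x κ : ℕ → E} {x' : E}
    {s : ℕ → α} {a : ℕ → ℝ} {C R ρ : ℝ} {N : ℕ} {p : α → α → ℝ} {q : E → α → ℝ}
    (hC : 0 ≤ C) (ha : ∀ k, 0 < a k) (ha2 : Summable fun k => a k ^ 2)
    (hasum : Tendsto (fun m => ∑ k ∈ Finset.range m, a (k + 1)) atTop atTop)
    (hstep : ∀ k, N ≤ k → x (k + 1) = x k + a k • κ k)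
    (hκ : ∀ k, ‖κ k‖ ^ 2 ≤ C * (1 + ‖x k - x'‖ ^ 2))
    (hR : ∀ k, ‖x k - x'‖ ^ 2 ≤ R)
    (hρ : 0 < ρ) (hp : ∀ i j, ρ ≤ p i j)
    (hq : ∀ j, Continuous fun y => q y j) (hq0 : ∀ y j, 0 ≤ q y j)
    (hqpos : ∀ y, y ≠ x' → 0 < ∑ j, q y j)
    (hT : ∃ l, Tendsto (fun m => ∑ k ∈ Finset.range m,
      a k * (inner ℝ (x k - x') (κ k) + q (x k) (s k))) atTop (𝓝 l))
    (hZ : ∃ l, Tendsto (fun m => ∑ k ∈ Finset.range m,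
      a (k + 1) * (q (x k) (s (k + 1)) - ∑ j, p (s k) j * q (x k) j)) atTop (𝓝 l)) :
    Tendsto x atTop (𝓝 x') := by
  have : ProperSpace E := FiniteDimensional.proper ℝ E
  obtain ⟨lT, hT⟩ := hT
  obtain ⟨lZ, hZ⟩ := hZ
  set T : ℕ → ℝ := fun m => ∑ k ∈ Finset.range m,
    a k * (inner ℝ (x k - x') (κ k) + q (x k) (s k)) with hTdef
  set Z : ℕ → ℝ := fun m => ∑ k ∈ Finset.range m,
    a (k + 1) * (q (x k) (s (k + 1)) - ∑ j, p (s k) j * q (x k) j) with hZdef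
  set Q : ℕ → ℝ := fun m => ∑ k ∈ Finset.range m, a k ^ 2 * ‖κ k‖ ^ 2 with hQdef
  have hκB : ∀ k, ‖κ k‖ ^ 2 ≤ C * (1 + R) := fun k => (hκ k).trans (by gcongr; exact hR k)
  have hQsum : Summable fun k => a k ^ 2 * ‖κ k‖ ^ 2 :=
    Summable.of_nonneg_of_le (fun k => by positivity)
      (fun k => mul_le_mul_of_nonneg_left (hκB k) (sq_nonneg _)) (ha2.mul_right _)
  have hQ := hQsum.hasSum.tendsto_sum_nat
  set U : ℕ → ℝ := fun k => ‖x k - x'‖ ^ 2 - (2 * T k + Q k) with hU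
  have hUstep : ∀ k, N ≤ k → U (k + 1) = U k - 2 * a k * q (x k) (s k) := by
    intro k hk
    simp only [hU, hTdef, hQdef, hstep k hk, norm_sq_step, Finset.sum_range_succ]
    ring
  have hTQ : Tendsto (fun k => 2 * T k + Q k) atTop (𝓝 (2 * lT + _)) := (hT.const_mul 2).add hQ
  obtain ⟨lU, hUl⟩ : ∃ l, Tendsto U atTop (𝓝 l) := by
    have hanti : Antitone fun k => U (k + N) := antitone_nat_of_succ_le fun k => by
      rw [show k + 1 + N = (k + N) + 1 by ring, hUstep _ (by omega)]
      have := mul_nonneg (mul_nonneg zero_le_two (ha (k + N)).le) (hq0 (x (k + N)) (s (k + N)))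
      linarith
    obtain ⟨b, hb⟩ := hTQ.bddAbove_range
    have hbdd : BddBelow (Set.range fun k => U (k + N)) := by
      refine ⟨-b, ?_⟩
      rintro _ ⟨k, rfl⟩
      have h1 := hb ⟨k + N, rfl⟩
      have h2 := sq_nonneg ‖x (k + N) - x'‖
      simp only [hU] at h1 ⊢
      linarith
    exact ⟨_, (tendsto_add_atTop_iff_nat N).1 (tendsto_atTop_ciInf hanti hbdd)⟩
  obtain ⟨v, hV⟩ : ∃ v, Tendsto (fun k => ‖x k - x'‖ ^ 2) atTop (𝓝 v) :=
    ⟨_, (hUl.add hTQ).congr fun k => by simp [hU]⟩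
  have hv0 : 0 ≤ v := ge_of_tendsto' hV fun k => sq_nonneg _
  rcases hv0.eq_or_lt with rfl | hv
  · rw [tendsto_iff_norm_sub_tendsto_zero]
    have := hV.sqrt
    simpa [Real.sqrt_sq (norm_nonneg _)] using this
  exfalso
  have hball : ∀ k, x k ∈ Metric.closedBall x' (√R) := fun k => by
    rw [Metric.mem_closedBall, dist_eq_norm]
    exact Real.le_sqrt_of_sq_le (hR k)
  obtain ⟨δ, hδ, hδf⟩ : ∃ δ, 0 < δ ∧ ∀ y ∈ Metric.closedBall x' (√R) ∩ {y | v / 2 ≤ ‖y - x'‖ ^ 2},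
      δ ≤ ∑ j, q y j := by
    refine IsCompact.exists_forall_le' (f := fun y => ∑ j, q y j)
      ((isCompact_closedBall x' (√R)).inter_right
      (isClosed_le continuous_const (by fun_prop)))
      (continuous_finsetSum _ fun j _ => hq j).continuousOn fun y hy => hqpos y ?_
    rintro rfl
    have := hy.2
    simp at this
    linarith
  have hVlow : ∀ᶠ k in atTop, v / 2 ≤ ‖x k - x'‖ ^ 2 :=
    hV.eventually_const_le (by linarith)
  have hdist : Tendsto (fun k => dist (x k) (x (k + 1))) atTop (𝓝 0) := by
    have ha0 : Tendsto a atTop (𝓝 0) := by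
      have := ha2.tendsto_atTop_zero.sqrt
      simpa [Real.sqrt_sq (ha _).le] using this
    have h0 : Tendsto (fun k => a k * √(C * (1 + R))) atTop (𝓝 0) := by
      simpa using ha0.mul_const (√(C * (1 + R)))
    refine squeeze_zero' (Eventually.of_forall fun k => dist_nonneg) ?_ h0
    filter_upwards [eventually_ge_atTop N] with k hk
    rw [hstep k hk, dist_self_add_right, norm_smul, Real.norm_eq_abs, abs_of_pos (ha k)]
    exact mul_le_mul_of_nonneg_left (Real.le_sqrt_of_sq_le (hκB k)) (ha k).le
  -- The gap met at time `k + 1` involves both `x (k + 1)` and `s (k + 1)`. Replacing `x (k + 1)` by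
  -- `x k`, fixed before `s (k + 1)` is drawn, allows averaging over the next state.
  have hclose : ∀ᶠ k in atTop, ∀ j, q (x k) j - ρ * δ / 2 ≤ q (x (k + 1)) j := by
    rw [eventually_all]
    intro j
    have huc := (isCompact_closedBall x' (√R)).uniformContinuousOn_of_continuous
      (hq j).continuousOn
    obtain ⟨η, hη, h⟩ := Metric.uniformContinuousOn_iff.1 huc (ρ * δ / 2) (by positivity)
    filter_upwards [hdist.eventually_lt_const hη] with k hk
    have := (abs_lt.1 (h _ (hball k) _ (hball (k + 1)) hk)).2
    linarith
  obtain ⟨N', hN'⟩ := eventually_atTop.1 (hVlow.and hclose)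
  -- The averaged decrease is at least `2 * ρ * δ` per unit step size and the replacement costs `ρ *
  -- δ`, so `Ψ` is still eventually nonincreasing, yet it tends to infinity.
  set Ψ : ℕ → ℝ := fun m =>
    (U (m + 1) + 2 * Z m) + ρ * δ * ∑ k ∈ Finset.range m, a (k + 1) with hΨ
  have hΨtop : Tendsto Ψ atTop atTop :=
    ((((tendsto_add_atTop_iff_nat 1).2 hUl).add (hZ.const_mul 2))).add_atTop
      (hasum.const_mul_atTop (by positivity))
  have hΨanti : Antitone fun m => Ψ (m + max N N') := antitone_nat_of_succ_le fun m => by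
    rw [show m + 1 + max N N' = (m + max N N') + 1 by ring]
    set k := m + max N N' with hk
    have hkN : N ≤ k := by omega
    have hkN' : N' ≤ k := by omega
    obtain ⟨h1, h2⟩ := hN' k hkN'
    have h3 : ρ * δ ≤ ∑ j, p (s k) j * q (x k) j := by
      calc ρ * δ ≤ ρ * ∑ j, q (x k) j := by gcongr; exact hδf _ ⟨hball k, h1⟩
        _ = ∑ j, ρ * q (x k) j := Finset.mul_sum _ _ _
        _ ≤ _ := Finset.sum_le_sum fun j _ => mul_le_mul_of_nonneg_right (hp _ _) (hq0 _ _)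
    have h4 := h2 (s (k + 1))
    have h5 : Ψ (k + 1) = Ψ k + a (k + 1) * (ρ * δ - 2 * q (x (k + 1)) (s (k + 1)) +
        2 * (q (x k) (s (k + 1)) - ∑ j, p (s k) j * q (x k) j)) := by
      simp only [hΨ, hUstep (k + 1) (by omega), hZdef, Finset.sum_range_succ]
      ring
    rw [h5]
    have h6 := mul_nonneg (ha (k + 1)).le (by linarith : 0 ≤ -(ρ * δ -
      2 * q (x (k + 1)) (s (k + 1)) + 2 * (q (x k) (s (k + 1)) - ∑ j, p (s k) j * q (x k) j)))
    linarith
  obtain ⟨m, hm⟩ := (((tendsto_add_atTop_iff_nat (max N N')).2 hΨtop).eventually_gt_atTop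
    (Ψ (0 + max N N'))).exists
  exact absurd hm (not_lt.2 (hΨanti (Nat.zero_le m)))

end Pathwise

/-! ### Almost sure convergence of the noise series -/

section Noise

variable {n : ℕ} {Ω : Type*} {S : ℕ → Ω → BinVec n}

lemma exists_transProb_ge (θ' : Param n) : ∃ ρ, 0 < ρ ∧ ∀ s s', ρ ≤ transProb θ' s s' := by
  obtain ⟨x, hx⟩ := Finite.exists_min fun x : BinVec n × BinVec n => transProb θ' x.1 x.2
  exact ⟨_, transProb_pos θ' x.1 x.2, fun s s' => hx (s, s')⟩

lemma exists_driftGap_le (θ' : Param n) (R : ℝ) :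
    ∃ B, ∀ θ s, ‖θ - θ'‖ ^ 2 ≤ R → driftGap θ' θ s ≤ B := by
  have h : ∀ s, ∃ B, ∀ θ ∈ Metric.closedBall θ' (√R), driftGap θ' θ s ≤ B := fun s => by
    obtain ⟨B, hB⟩ := ((isCompact_closedBall θ' (√R)).image (continuous_driftGap θ' s)).bddAbove
    exact ⟨B, fun θ hθ => hB ⟨θ, hθ, rfl⟩⟩
  choose B hB using h
  obtain ⟨s₀, hs₀⟩ := Finite.exists_max B
  refine ⟨B s₀, fun θ s hθ => (hB s θ ?_).trans (hs₀ s)⟩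
  rw [Metric.mem_closedBall, dist_eq_norm]
  exact Real.le_sqrt_of_sq_le hθ

lemma exists_abs_inner_score_le (θ' : Param n) :
    ∃ C, 0 ≤ C ∧ ∀ θ s, |inner ℝ (θ - θ') (score θ s)| ≤ C * (1 + ‖θ - θ'‖ ^ 2) := by
  obtain ⟨C, hC, h⟩ := exists_norm_sq_score_le θ'
  refine ⟨1 + C, by linarith, fun θ s => (abs_real_inner_le_norm _ _).trans ?_⟩
  nlinarith [h θ s, sq_nonneg (‖θ - θ'‖ - ‖score θ s‖), sq_nonneg (‖θ - θ'‖ + ‖score θ s‖)]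

variable [MeasurableSpace Ω] {P : Measure Ω} [IsProbabilityMeasure P] {θ' : Param n}
  {θ : ℕ → Ω → Param n}

/-- Since `-driftGap` is the conditional mean, each term is an innovation. The weight `r` makes it
bounded: a reciprocal for the plain recursion, a ball indicator elsewhere. -/
lemma ae_tendsto_sum_score_noise (hS : ∀ k, Measurable (S k))
    (hchain : HasTransProb P S (transProb θ')) (hθ : ∀ k, DependsOnTraj S k (θ k))
    {a : ℕ → ℝ} (ha : Summable fun k => a k ^ 2) {r : Param n → ℝ} {B : ℝ}
    (hr : ∀ η, |r η| * (1 + ‖η - θ'‖ ^ 2) ≤ B) :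
    ∀ᵐ ω ∂P, ∃ l, Tendsto (fun m => ∑ k ∈ Finset.range m, a k * (r (θ k ω) *
      (inner ℝ (θ k ω - θ') (score (θ k ω) (S (k + 1) ω, S k ω)) +
        driftGap θ' (θ k ω) (S k ω)))) atTop (𝓝 l) := by
  obtain ⟨C, hC, hCi⟩ := exists_abs_inner_score_le θ'
  have h := hchain.ae_tendsto_sum_innovation hS (fun s s' => (transProb_pos θ' s s').le)
    (sum_transProb θ')
    (G := fun k ω s => r (θ k ω) * inner ℝ (θ k ω - θ') (score (θ k ω) (s, S k ω)))
    (fun k ω ω' h => by simp only [hθ k h, dependsOnTraj_state S le_rfl h])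
    (C := C * B) (fun k ω s => ?_) ha
  · filter_upwards [h] with ω hω
    convert hω using 7 with l m k
    rw [innovation, mul_add]
    simp_rw [mul_left_comm _ (r (θ k ω))]
    rw [← Finset.mul_sum, sum_transProb_mul_inner_score]
    ring
  · rw [abs_mul]
    calc _ ≤ |r (θ k ω)| * (C * (1 + ‖θ k ω - θ'‖ ^ 2)) := by gcongr; exact hCi _ _
      _ = C * (|r (θ k ω)| * (1 + ‖θ k ω - θ'‖ ^ 2)) := by ring
      _ ≤ C * B := by gcongr; exact hr _

/-- Natural radii give one null set for all `R`, so `R` may later depend on the path. -/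
lemma ae_tendsto_sum_truncated_score_noise (hS : ∀ k, Measurable (S k))
    (hchain : HasTransProb P S (transProb θ')) (hθ : ∀ k, DependsOnTraj S k (θ k))
    {a : ℕ → ℝ} (ha : Summable fun k => a k ^ 2) :
    ∀ᵐ ω ∂P, ∀ R : ℕ, ∃ l, Tendsto (fun m => ∑ k ∈ Finset.range m,
      a k * ((if ‖θ k ω - θ'‖ ^ 2 ≤ R then 1 else 0) *
        (inner ℝ (θ k ω - θ') (score (θ k ω) (S (k + 1) ω, S k ω)) +
          driftGap θ' (θ k ω) (S k ω)))) atTop (𝓝 l) := by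
  refine ae_all_iff.2 fun R => ae_tendsto_sum_score_noise hS hchain hθ ha
    (r := fun η => if ‖η - θ'‖ ^ 2 ≤ R then 1 else 0) (B := 1 + R) fun η => ?_
  split_ifs with h
  · simpa using h
  · simp only [abs_zero, zero_mul]; positivity

lemma ae_tendsto_sum_truncated_driftGap_noise (hS : ∀ k, Measurable (S k))
    (hchain : HasTransProb P S (transProb θ')) (hθ : ∀ k, DependsOnTraj S k (θ k))
    {b : ℕ → ℝ} (hb : Summable fun k => b k ^ 2) :
    ∀ᵐ ω ∂P, ∀ R : ℕ, ∃ l, Tendsto (fun m => ∑ k ∈ Finset.range m,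
      b k * ((if ‖θ k ω - θ'‖ ^ 2 ≤ R then 1 else 0) *
        (driftGap θ' (θ k ω) (S (k + 1) ω) -
          ∑ s, transProb θ' (S k ω) s * driftGap θ' (θ k ω) s))) atTop (𝓝 l) := by
  refine ae_all_iff.2 fun R => ?_
  obtain ⟨B, hB⟩ := exists_driftGap_le θ' R
  have h := hchain.ae_tendsto_sum_innovation hS (fun s s' => (transProb_pos θ' s s').le)
    (sum_transProb θ')
    (G := fun k ω s => (if ‖θ k ω - θ'‖ ^ 2 ≤ R then 1 else 0) * driftGap θ' (θ k ω) s)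
    (fun k ω ω' h => by simp only [hθ k h])
    (C := |B|) (fun k ω s => ?_) hb
  · filter_upwards [h] with ω hω
    convert hω using 7 with l m k
    rw [innovation, mul_sub]
    simp_rw [mul_left_comm _ (ite _ _ _)]
    rw [← Finset.mul_sum]
  · split_ifs with h
    · rw [one_mul, abs_of_nonneg (driftGap_nonneg _ _ _)]
      exact (hB _ _ h).trans (le_abs_self B)
    · simp

/-- Adapted sequences that stay bounded and eventually follow the recursion converge to the true
parameter. -/
lemma ae_tendsto_of_bounded (hS : ∀ k, Measurable (S k))
    (hchain : HasTransProb P S (transProb θ')) (hθ : ∀ k, DependsOnTraj S k (θ k))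
    {a : ℕ → ℝ} (ha : StepSize a)
    (hbdd : ∀ᵐ ω ∂P, ∃ R : ℕ, ∀ k, ‖θ k ω - θ'‖ ^ 2 ≤ R)
    (hstep : ∀ᵐ ω ∂P, ∀ᶠ k in atTop, θ (k + 1) ω = update a S θ k ω) :
    ∀ᵐ ω ∂P, Tendsto (fun k => θ k ω) atTop (𝓝 θ') := by
  obtain ⟨C, hC, hCs⟩ := exists_norm_sq_score_le θ'
  obtain ⟨ρ, hρ, hρp⟩ := exists_transProb_ge θ'
  have hsum : Tendsto (fun m => ∑ k ∈ Finset.range m, a (k + 1)) atTop atTop := by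
    refine ha.sum_eq_top.congr fun m => ?_
    rw [show Finset.Icc 1 m = Finset.Ico 1 (m + 1) from rfl, Finset.sum_Ico_eq_sum_range]
    simp [add_comm]
  filter_upwards [hbdd, hstep, ae_tendsto_sum_truncated_score_noise hS hchain hθ ha.sum_sq,
    ae_tendsto_sum_truncated_driftGap_noise hS hchain hθ
      ((summable_nat_add_iff 1).2 ha.sum_sq)] with ω ⟨R, hR⟩ hω hT hZ
  obtain ⟨N, hN⟩ := eventually_atTop.1 hω
  refine tendsto_of_step (s := fun k => S k ω) (p := transProb θ') (q := driftGap θ')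
    (κ := fun k => score (θ k ω) (S (k + 1) ω, S k ω)) hC ha.pos ha.sum_sq hsum hN
    (fun k => hCs _ _) hR hρ hρp (continuous_driftGap θ') (driftGap_nonneg θ')
    (fun y hy => sum_driftGap_pos hy) ?_ ?_
  -- With `R` the bound of this path, every cutoff equals `1`.
  · simpa only [hR, if_true, one_mul] using hT R
  · simpa only [hR, if_true, one_mul] using hZ R

end Noise

/-! ### Consistency of the two algorithms -/

section Estimates

variable {n : ℕ} {Ω : Type*} {S : ℕ → Ω → BinVec n} {a M : ℕ → ℝ} {θ₀ θ' : Param n}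
  {θ : ℕ → Ω → Param n} {σ : ℕ → Ω → ℕ}

lemma dependsOnTraj_update {k : ℕ} (hθ : DependsOnTraj S k (θ k)) :
    DependsOnTraj S (k + 1) (update a S θ k) := fun ω ω' h => by
  simp only [update, auxChain, hθ (traj_eq_of_le k.le_succ h), dependsOnTraj_state S le_rfl h,
    dependsOnTraj_state S (Nat.sub_le (k + 1) 1) h]

lemma IsEstimate.dependsOnTraj (h : IsEstimate a S θ₀ θ) (k : ℕ) : DependsOnTraj S k (θ k) := by
  induction k with
  | zero => exact fun ω ω' _ => by rw [h.init, h.init]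
  | succ k ih => exact fun ω ω' hω => by rw [h.step, h.step, dependsOnTraj_update ih hω]

lemma IsTruncatedEstimate.dependsOnTraj (h : IsTruncatedEstimate a M S θ₀ θ σ) (k : ℕ) :
    DependsOnTraj S k (θ k) ∧ DependsOnTraj S k (σ k) := by
  induction k using Nat.strong_induction_on with
  | _ k ih =>
    constructor
    · cases k with
      | zero => exact fun ω ω' _ => by rw [h.init, h.init]
      | succ k =>
        intro ω ω' hω
        rw [h.step, h.step, dependsOnTraj_update (ih k k.lt_succ_self).1 hω,
          (ih k k.lt_succ_self).2 (traj_eq_of_le k.le_succ hω)]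
    · intro ω ω' hω
      rw [h.count, h.count]
      refine Finset.sum_congr rfl fun i hi => ?_
      have hi := (Finset.mem_Ico.1 hi).2
      rw [(ih i hi).2 (traj_eq_of_le hi.le hω),
        dependsOnTraj_update (ih i hi).1 (traj_eq_of_le hi hω)]

lemma IsTruncatedEstimate.count_le_card (h : IsTruncatedEstimate a M S θ₀ θ σ) {ω : Ω}
    (hfin : {k | M (σ k ω) < ‖update a S θ k ω‖}.Finite) (k : ℕ) :
    σ k ω ≤ hfin.toFinset.card := by
  rw [h.count, Finset.sum_boole]
  exact Finset.card_le_card fun i hi => by simpa using (Finset.mem_filter.1 hi).2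

/-- The truncation count, hence the active level, stays bounded; only `θ₀` may lie above it. -/
lemma IsTruncatedEstimate.bounded (h : IsTruncatedEstimate a M S θ₀ θ σ) (hM0 : ∀ k, 0 < M k)
    (hM : Monotone M) {ω : Ω} (hfin : {k | M (σ k ω) < ‖update a S θ k ω‖}.Finite) :
    ∃ R : ℕ, ∀ k, ‖θ k ω - θ'‖ ^ 2 ≤ R := by
  set b := max ‖θ₀‖ (M hfin.toFinset.card)
  have hb : ∀ k, ‖θ k ω‖ ≤ b := fun k => by
    cases k with
    | zero => rw [h.init]; exact le_max_left _ _
    | succ k =>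
      refine le_trans ?_ ((hM (h.count_le_card hfin k)).trans (le_max_right _ _))
      rw [h.step]
      split_ifs with hk
      · exact hk
      · simpa using (hM0 _).le
  obtain ⟨R, hR⟩ := exists_nat_ge ((b + ‖θ'‖) ^ 2)
  refine ⟨R, fun k => le_trans ?_ hR⟩
  gcongr
  exact (norm_sub_le _ _).trans (by gcongr; exact hb k)

variable [MeasurableSpace Ω] {P : Measure Ω} [IsProbabilityMeasure P]

theorem IsEstimate.ae_tendsto (h : IsEstimate a S θ₀ θ) (hS : ∀ k, Measurable (S k))
    (hchain : HasTransProb P S (transProb θ')) (ha : StepSize a) :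
    ∀ᵐ ω ∂P, Tendsto (fun k => θ k ω) atTop (𝓝 θ') := by
  refine ae_tendsto_of_bounded hS hchain h.dependsOnTraj ha ?_
    (Eventually.of_forall fun ω => Eventually.of_forall fun k => h.step k ω)
  obtain ⟨C, hC, hCs⟩ := exists_norm_sq_score_le θ'
  have hnoise := ae_tendsto_sum_score_noise hS hchain h.dependsOnTraj ha.sum_sq
    (r := fun η => (1 + ‖η - θ'‖ ^ 2)⁻¹) (B := 1) fun η => by
      have hpos : 0 < 1 + ‖η - θ'‖ ^ 2 := by positivity
      rw [abs_of_pos (inv_pos.2 hpos), inv_mul_cancel₀ hpos.ne']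
  filter_upwards [hnoise] with ω hω
  exact bounded_of_step hC ha.pos ha.sum_sq (fun k => h.step k ω) (fun k => hCs _ _)
    (fun k => le_add_of_nonneg_right (driftGap_nonneg _ _ _)) hω

theorem IsTruncatedEstimate.ae_finite_truncations (h : IsTruncatedEstimate a M S θ₀ θ σ)
    (hS : ∀ k, Measurable (S k)) {θ' : Param n} (hchain : HasTransProb P S (transProb θ'))
    (ha : StepSize a) (hM : Tendsto M atTop atTop) :
    ∀ᵐ ω ∂P, {k | M (σ k ω) < ‖update a S θ k ω‖}.Finite := by
  obtain ⟨C, hC, hCs⟩ := exists_norm_sq_score_le θ'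
  filter_upwards [ae_tendsto_sum_truncated_score_noise hS hchain
    (fun k => (h.dependsOnTraj k).1) ha.sum_sq] with ω hω
  exact finite_truncations hC ha.pos ha.sum_sq hM (fun k => h.step k ω) (fun k => h.count k ω)
    (fun k => hCs _ _) (fun k => le_add_of_nonneg_right (driftGap_nonneg _ _ _)) hω

theorem IsTruncatedEstimate.ae_tendsto (h : IsTruncatedEstimate a M S θ₀ θ σ)
    (hS : ∀ k, Measurable (S k)) (hchain : HasTransProb P S (transProb θ')) (ha : StepSize a)
    (hM0 : ∀ k, 0 < M k) (hMmono : Monotone M) (hM : Tendsto M atTop atTop) :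
    ∀ᵐ ω ∂P, Tendsto (fun k => θ k ω) atTop (𝓝 θ') := by
  have hfin := h.ae_finite_truncations hS hchain ha hM
  refine ae_tendsto_of_bounded hS hchain (fun k => (h.dependsOnTraj k).1) ha ?_ ?_
  · filter_upwards [hfin] with ω hω using h.bounded hM0 hMmono hω
  · filter_upwards [hfin] with ω hω
    have := hω.eventually_cofinite_notMem
    rw [Nat.cofinite_eq_atTop] at this
    filter_upwards [this] with k hk
    rw [h.step, if_pos (not_lt.1 hk)]

end Estimates

end BinaryNetwork

end

theorem theorem5 {n : ℕ} (hn : 2 ≤ n)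
    {Ω : Type*} [MeasurableSpace Ω] (P : Measure Ω) [IsProbabilityMeasure P]
    (A : Matrix (Fin n) (Fin n) ℝ) (c : Fin n → ℝ)
    (D Y : ℕ → Ω → Fin n → ℝ) (S : ℕ → Ω → BinaryNetwork.BinVec n)
    (hY : Measurable (Y 0))
    (hsys : BinaryNetwork.IsSystem A c D Y S)
    (hD : BinaryNetwork.GaussianDisturbances P D (S 0))
    (a : ℕ → ℝ) (ha : BinaryNetwork.StepSize a)
    (θ₀ : BinaryNetwork.Param n) :
    (∀ θ : ℕ → Ω → BinaryNetwork.Param n, BinaryNetwork.IsEstimate a S θ₀ θ →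
      ∀ᵐ ω ∂P, Tendsto (fun k => θ k ω) atTop (𝓝 (BinaryNetwork.vec A c))) ∧
    (∀ M : ℕ → ℝ, (∀ k, 0 < M k) → Monotone M → Tendsto M atTop atTop →
      ∀ (θ : ℕ → Ω → BinaryNetwork.Param n) (σ : ℕ → Ω → ℕ),
        BinaryNetwork.IsTruncatedEstimate a M S θ₀ θ σ →
        (∀ᵐ ω ∂P, Tendsto (fun k => θ k ω) atTop (𝓝 (BinaryNetwork.vec A c))) ∧
        (∀ᵐ ω ∂P, {k | M (σ k ω) < ‖BinaryNetwork.update a S θ k ω‖}.Finite)) := by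
  have hS := hsys.measurable_state hY hD
  have hchain := hsys.hasTransProb hD
  exact ⟨fun θ hθ => hθ.ae_tendsto hS hchain ha, fun M hM0 hMmono hM θ σ hθ =>
    ⟨hθ.ae_tendsto hS hchain ha hM0 hMmono hM, hθ.ae_finite_truncations hS hchain ha hM⟩⟩
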